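/- **Theorem (Taut Configurations).** Let $G$ be a connected (finite-dimensional, real, smooth) Lie group with identity $e$, Lie algebra $\mathfrak g$ and exponential map $\exp:\mathfrak g\to G$. Let $P(\mathfrak g)$ be the projective space of lines through the origin in $\mathfrak g$, with the quotient topology, and for a positive definite inner product on $\mathfrak g$ let $S(\mathfrak g)$ be the unit sphere. An unoriented (respectively oriented) continuous Kakeya line configuration is a continuous map $\sigma:P(\mathfrak g)\to G$ (respectively $\sigma:S(\mathfrak g)\to G$); its underlying space is $$|\sigma|=\bigcup_{L\in P(\mathfrak g)}\sigma(L)\exp(L)\qquad\Bigl(\text{respectively } |\sigma|=\bigcup_{x\in S(\mathfrak g)}\sigma(x)\exp(\mathbb R x)\Bigr).$$ The configuration $\sigma$ is called taut if its image lies in an open neighbourhood $U$ of $e$ in $G$ for which there is an open neighbourhood $V$ of $0$ in $\mathfrak g$ such that $\exp$ restricts to a diffeomorphism $V\to U$. 1. If $\dim G\ge 1$ and $\sigma:P(\mathfrak g)\to G$ is a taut unoriented configuration, then $|\sigma|$ contains an open neighbourhood of $e$; $|\sigma|$ is a Borel set, and it has positive measure for every left Haar measure on $G$. 2. If $\dim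 G$ is odd, then for every positive definite inner product on $\mathfrak g$ and every taut oriented configuration $\sigma:S(\mathfrak g)\to G$, the set $|\sigma|$ contains an open neighbourhood of $e$; $|\sigma|$ is a Borel set, and it has positive measure for every left Haar measure on $G$. -/

import Mathlib

open scoped Manifold ContDiff LinearAlgebra.Projectivization

noncomputable section

namespace Kakeya

/-- The quotient topology on the projective space of a topological vector space `V`: the finest
topology for which the projection `V \ {0} → ℙ K V` is continuous. -/
instance projectivizationTopology (K V : Type*) [DivisionRing K] [AddCommGroup V] [Module K V]
    [TopologicalSpace V] : TopologicalSpace (ℙ K V) :=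
  TopologicalSpace.coinduced (Projectivization.mk' K : {v : V // v ≠ 0} → ℙ K V) inferInstance

/-- The unit sphere of a real vector space with respect to a positive definite inner product `B`. -/
def unitSphere {V : Type*} [AddCommGroup V] [Module ℝ V] (B : InnerProductSpace.Core ℝ V) :
    Set V :=
  {v | B.inner v v = 1}

section Exponential

variable {E : Type*} [NormedAddCommGroup E] [NormedSpace ℝ E]
  {H : Type*} [TopologicalSpace H] {I : ModelWithCorners ℝ E H}
  {G : Type*} [TopologicalSpace G] [ChartedSpace H G] [Group G] [LieGroup I ∞ G]

/-- Left-invariant vector fields are invariant under left translations. -/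
theorem mfderiv_mulInvariantVectorField (v : GroupLieAlgebra I G) (g h : G) :
    mfderiv I I (g * ·) h (mulInvariantVectorField v h) = mulInvariantVectorField v (g * h) := by
  have hne : (∞ : WithTop ℕ∞) ≠ 0 := by simp
  have D : (fun x : G ↦ g * h * x) = (fun x ↦ g * x) ∘ (fun x ↦ h * x) := by
    ext x; simp [mul_assoc]
  have A : mfderiv I I (fun x : G ↦ g * h * x) 1 =
      (mfderiv I I (fun x ↦ g * x) (h * 1)).comp (mfderiv I I (fun x ↦ h * x) 1) := by
    rw [D]
    exact mfderiv_comp (I' := I) _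
      ((contMDiff_mul_left (I := I) (n := ∞)).contMDiffAt.mdifferentiableAt hne)
      ((contMDiff_mul_left (I := I) (n := ∞)).contMDiffAt.mdifferentiableAt hne)
  have B : mfderiv I I (g * ·) (h * 1) (mfderiv I I (h * ·) 1 v) =
      mfderiv I I (g * h * ·) 1 v := by rw [A]; rfl
  unfold mulInvariantVectorField
  rw [← B]
  congr 2
  all_goals simp

theorem isManifold_one : IsManifold I 1 G :=
  have : IsManifold I ∞ G := inferInstance
  IsManifold.of_le (n := ∞) (by simp)

theorem contMDiff_leftInvariant (v : GroupLieAlgebra I G) :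
    have : IsManifold I 1 G := isManifold_one
    ContMDiff I I.tangent 1
      (fun g : G ↦ (⟨g, mulInvariantVectorField v g⟩ : TangentBundle I G)) := by
  have : IsManifold I 1 G := isManifold_one
  have : LieGroup I (minSmoothness ℝ 3) G := by
    rw [minSmoothness_of_isRCLikeNormedField]
    exact LieGroup.of_le (n := ∞) (by exact WithTop.coe_le_coe.2 le_top)
  exact (contMDiff_mulInvariantVectorField v).of_le
    (by rw [minSmoothness_of_isRCLikeNormedField]; norm_num)

/-- Every left-invariant vector field has a global integral curve through the identity. -/
theorem exists_integralCurve [FiniteDimensional ℝ E] [I.Boundaryless] [T2Space G]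
    (v : GroupLieAlgebra I G) :
    ∃ γ : ℝ → G, γ 0 = 1 ∧ IsMIntegralCurve γ (mulInvariantVectorField (I := I) v) := by
  have : CompleteSpace E := FiniteDimensional.complete ℝ E
  have : IsManifold I 1 G := isManifold_one
  have hv := contMDiff_leftInvariant v
  obtain ⟨γ, h0, hγ⟩ := exists_isMIntegralCurveAt_of_contMDiffAt_boundaryless 0
    (hv.contMDiffAt (x := (1 : G)))
  rw [isMIntegralCurveAt_iff'] at hγ
  obtain ⟨ε, hε, hγ⟩ := hγ
  refine exists_isMIntegralCurve_of_isMIntegralCurveOn hv hε (fun g ↦ ⟨fun t ↦ g * γ t, ?_, ?_⟩) 1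
  · simp [h0]
  · intro t ht
    have ht' : t ∈ Metric.ball (0 : ℝ) ε := by rwa [Real.ball_eq_Ioo, zero_sub, zero_add]
    have h1 := hγ t ht'
    rw [Real.ball_eq_Ioo, zero_sub, zero_add] at h1
    have h2 : HasMFDerivAt I I (g * ·) (γ t) (mfderiv I I (g * ·) (γ t)) :=
      ((contMDiff_mul_left (I := I) (n := ∞)).contMDiffAt.mdifferentiableAt (by simp)).hasMFDerivAt
    have h3 := h2.comp_hasMFDerivWithinAt t h1
    refine h3.congr_mfderiv ?_
    refine ContinuousLinearMap.ext fun (s : ℝ) ↦ ?_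
    change mfderiv I I (g * ·) (γ t) (s • mulInvariantVectorField v (γ t)) =
      s • mulInvariantVectorField v (g * γ t)
    rw [map_smul, mfderiv_mulInvariantVectorField]

/-- The exponential map `exp : 𝔤 → G` of a Lie group: `exp v = γ 1`, where `γ : ℝ → G` is the
integral curve with `γ 0 = 1` of the left-invariant vector field determined by `v`. -/
def lieExp [FiniteDimensional ℝ E] [I.Boundaryless] [T2Space G] (v : GroupLieAlgebra I G) : G :=
  (exists_integralCurve v).choose 1

/-- The integral curve in the definition of the exponential map is unique. -/
theorem lieExp_eq [FiniteDimensional ℝ E] [I.Boundaryless] [T2Space G] (v : GroupLieAlgebra I G)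
    (γ : ℝ → G) (h0 : γ 0 = 1) (hγ : IsMIntegralCurve γ (mulInvariantVectorField (I := I) v)) :
    lieExp v = γ 1 := by
  have : CompleteSpace E := FiniteDimensional.complete ℝ E
  have : IsManifold I 1 G := isManifold_one
  have h := (exists_integralCurve v).choose_spec
  exact congrFun (isMIntegralCurve_Ioo_eq_of_contMDiff_boundaryless (t₀ := 0)
    (contMDiff_leftInvariant v) h.2 hγ (h.1.trans h0.symm)) 1

variable (I) in
/-- A map `σ : X → G` is taut if its image lies in an open neighbourhood of the identity which is
diffeomorphic, via a local inverse of the exponential map, to an open neighbourhood of `0` in the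
Lie algebra. (The vector space underlying the Lie algebra, the tangent space at the identity, is by
definition the model space `E`.) -/
def IsTaut [FiniteDimensional ℝ E] [I.Boundaryless] [T2Space G] {X : Type*} (σ : X → G) : Prop :=
  ∃ φ : OpenPartialHomeomorph E G,
    0 ∈ φ.source ∧ 1 ∈ φ.target ∧ (∀ v ∈ φ.source, φ v = lieExp (I := I) (G := G) v) ∧
    ContMDiffOn 𝓘(ℝ, E) I ∞ φ φ.source ∧
    ContMDiffOn I 𝓘(ℝ, E) ∞ φ.symm φ.target ∧
    Set.range σ ⊆ φ.target

variable (I) in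
/-- The underlying space `⋃ L, σ(L) exp(L)` of an unoriented configuration. -/
def unorientedSpace [FiniteDimensional ℝ E] [I.Boundaryless] [T2Space G]
    (σ : ℙ ℝ (GroupLieAlgebra I G) → G) : Set G :=
  ⋃ L : ℙ ℝ (GroupLieAlgebra I G),
    (fun v : GroupLieAlgebra I G ↦ σ L * lieExp v) '' (L.submodule : Set (GroupLieAlgebra I G))

variable (I) in
/-- The underlying space `⋃ x, σ(x) exp(ℝx)` of an oriented configuration. -/
def orientedSpace [FiniteDimensional ℝ E] [I.Boundaryless] [T2Space G]
    (B : InnerProductSpace.Core ℝ (GroupLieAlgebra I G)) (σ : unitSphere B → G) : Set G :=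
  ⋃ x : unitSphere B,
    Set.range fun t : ℝ ↦ σ x * lieExp (t • (x : GroupLieAlgebra I G))

end Exponential

end Kakeya

end

noncomputable section

open MeasureTheory Set
open scoped ENNReal NNReal Manifold ContDiff

namespace Kakeya

/-- The determinant, as a continuous alternating map of the rows. -/
def detAlternating (n : ℕ) : (Fin n → ℝ) [⋀^Fin n]→L[ℝ] ℝ :=
  { (Matrix.detRowAlternating : (Fin n → ℝ) [⋀^Fin n]→ₗ[ℝ] ℝ) with
    cont := by
      change Continuous fun M : Fin n → Fin n → ℝ ↦ Matrix.det (Matrix.of M)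
      exact Continuous.matrix_det (by fun_prop) }

theorem detAlternating_apply_comp {n : ℕ} (A : (Fin n → ℝ) →L[ℝ] (Fin n → ℝ)) :
    detAlternating n (fun i ↦ A (Pi.single i 1)) = A.det := by
  change Matrix.det (Matrix.of fun i ↦ A (Pi.single i 1)) =
    LinearMap.det (A : (Fin n → ℝ) →ₗ[ℝ] (Fin n → ℝ))
  rw [← LinearMap.det_toMatrix', ← Matrix.det_transpose]
  rfl

/-- An alternating form whose degree exceeds the dimension vanishes. -/
theorem continuousAlternatingMap_succ_eq_zero {n : ℕ}
    (α : (Fin n → ℝ) [⋀^Fin (n + 1)]→L[ℝ] ℝ) : α = 0 := by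
  ext v
  refine α.toAlternatingMap.map_linearDependent v fun h ↦ ?_
  have := h.fintype_card_le_finrank
  simp at this

/-- Homotopy invariance of the degree integral. -/
theorem integral_comp_mul_det_fderiv_eq {n : ℕ} {h : (Fin (n + 1) → ℝ) → Fin n → ℝ}
    (hh : ContDiff ℝ ∞ h) {φ : (Fin n → ℝ) → ℝ} (hφ : ContDiff ℝ ∞ φ)
    (h0 : ∀ t ∈ Icc (0 : ℝ) 1, ∀ x : Fin n → ℝ, ‖x‖ = 1 → φ (h (Fin.cons t x)) = 0) :
    ∫ x in Icc (-1 : Fin n → ℝ) 1, φ (h (Fin.cons 1 x)) *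
        (fderiv ℝ (fun x : Fin n → ℝ ↦ h (Fin.cons 1 x)) x).det =
      ∫ x in Icc (-1 : Fin n → ℝ) 1, φ (h (Fin.cons 0 x)) *
        (fderiv ℝ (fun x : Fin n → ℝ ↦ h (Fin.cons 0 x)) x).det := by
  set w : (Fin n → ℝ) → (Fin n → ℝ) [⋀^Fin n]→L[ℝ] ℝ := fun y ↦ φ y • detAlternating n with hw
  have hwd : ContDiff ℝ ∞ w := hφ.smul contDiff_const
  set η : (Fin (n + 1) → ℝ) → (Fin (n + 1) → ℝ) [⋀^Fin n]→L[ℝ] ℝ :=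
    fun z ↦ (w (h z)).compContinuousLinearMap (fderiv ℝ h z) with hη
  have hηd : Differentiable ℝ η := fun z ↦
    ((hwd.differentiable (by simp)).comp
      (hh.differentiable (by simp)) z).continuousAlternatingMapCompContinuousLinearMap
      ((hh.fderiv_right (m := 1) (by exact WithTop.coe_le_coe.2 le_top)).differentiable
        (by simp) z)
  have hdη : ∀ z, extDeriv η z = 0 := fun z ↦ by
    rw [hη, extDeriv_pullback (r := ∞) (hwd.differentiable (by simp) _) hh.contDiffAt (by
      rw [minSmoothness_of_isRCLikeNormedField]; exact WithTop.coe_le_coe.2 le_top),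
      continuousAlternatingMap_succ_eq_zero (extDeriv w (h z))]
    rfl
  set e : Fin (n + 1) → Fin (n + 1) → ℝ := fun i ↦ Pi.single i 1 with he
  have hηa : ∀ (z) (v : Fin n → Fin (n + 1) → ℝ),
      η z v = φ (h z) * detAlternating n (fun i ↦ fderiv ℝ h z (v i)) := fun z v ↦ rfl
  have hz : ∀ z, ∑ i : Fin (n + 1), ((-1 : ℝ) ^ (i : ℕ) •
      (ContinuousAlternatingMap.apply ℝ (Fin (n + 1) → ℝ) ℝ (i.removeNth e) ∘L fderiv ℝ η z))
      (Pi.single i 1) = 0 := fun z ↦ by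
    have := congrArg (fun α ↦ α e) (hdη z)
    rw [extDeriv] at this
    simp only [ContinuousAlternatingMap.alternatizeUncurryFin_apply] at this
    simpa using this
  have key := integral_divergence_of_hasFDerivAt_off_countable' (n := n) (E := ℝ)
    (Fin.cons 0 (-1)) (Fin.cons 1 1) (by
      intro i; refine Fin.cases ?_ (fun j ↦ ?_) i <;> simp)
    (fun i z ↦ (-1) ^ (i : ℕ) * η z (i.removeNth e))
    (fun i z ↦ (-1 : ℝ) ^ (i : ℕ) •
      (ContinuousAlternatingMap.apply ℝ (Fin (n + 1) → ℝ) ℝ (i.removeNth e) ∘L fderiv ℝ η z))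
    ∅ countable_empty ?_ ?_ ?_
  · simp only [hz, integral_zero] at key
    rw [Fin.sum_univ_succ, Finset.sum_eq_zero, add_zero] at key
    · have hslice : ∀ (t : ℝ) (x : Fin n → ℝ),
          (-1 : ℝ) ^ ((0 : Fin (n + 1)) : ℕ) *
            η ((0 : Fin (n + 1)).insertNth t x) ((0 : Fin (n + 1)).removeNth e) =
          φ (h (Fin.cons t x)) * (fderiv ℝ (fun x : Fin n → ℝ ↦ h (Fin.cons t x)) x).det := by
        intro t x
        have hc : HasFDerivAt (fun x : Fin n → ℝ ↦ (Fin.cons t x : Fin (n + 1) → ℝ))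
            (ContinuousLinearMap.pi (Fin.cons (0 : (Fin n → ℝ) →L[ℝ] ℝ)
              fun j ↦ ContinuousLinearMap.proj j)) x := by
          rw [hasFDerivAt_pi']
          intro i
          refine Fin.cases ?_ (fun j ↦ ?_) i
          · simpa using! hasFDerivAt_const t x
          · simpa using! hasFDerivAt_apply (𝕜 := ℝ) j x
        have hd := ((hh.differentiable (by simp) (Fin.cons t x)).hasFDerivAt.comp x hc).fderiv
        rw [Function.comp_def] at hd
        rw [hηa, hd, ← detAlternating_apply_comp]
        simp only [Fin.coe_ofNat_eq_mod, Nat.zero_mod, pow_zero, one_mul, Fin.insertNth_zero']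
        congr 3
        ext1 i
        rw [ContinuousLinearMap.comp_apply]
        congr 1
        ext k
        refine Fin.cases ?_ (fun j ↦ ?_) k
        · simp [he, Fin.removeNth]
        · simp [he, Fin.removeNth, Pi.single_apply]
      have := sub_eq_zero.1 key.symm
      simpa only [hslice, Fin.succAbove_zero, Function.comp_def, Fin.cons_zero, Fin.cons_succ]
        using! this
    · intro j _
      have hface : ∀ c : ℝ, |c| = 1 →
          ∀ x ∈ Icc ((Fin.cons 0 (-1) : Fin (n + 1) → ℝ) ∘ j.succ.succAbove)
            ((Fin.cons 1 1 : Fin (n + 1) → ℝ) ∘ j.succ.succAbove),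
          (-1 : ℝ) ^ (j.succ : ℕ) * η (j.succ.insertNth c x) (j.succ.removeNth e) = 0 := by
        intro c hc x hx
        set z : Fin (n + 1) → ℝ := j.succ.insertNth c x with hz'
        have hzj : z j.succ = c := by simp [hz']
        have hzk : ∀ i, (Fin.cons 0 (-1) : Fin (n + 1) → ℝ) i ≤ z i ∧
            z i ≤ (Fin.cons 1 1 : Fin (n + 1) → ℝ) i := fun i ↦ by
          rcases Fin.eq_self_or_eq_succAbove j.succ i with rfl | ⟨k, rfl⟩
          · rw [hzj]
            simpa using abs_le.1 hc.le
          · simpa [hz'] using! ⟨hx.1 k, hx.2 k⟩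
        have hnorm : ‖Fin.tail z‖ = 1 := by
          refine le_antisymm ((pi_norm_le_iff_of_nonneg zero_le_one).2 fun i ↦ ?_) ?_
          · rw [Real.norm_eq_abs, abs_le]
            simpa using! hzk i.succ
          · rw [← hc, ← hzj]
            exact norm_le_pi_norm (Fin.tail z) j
        have h1 := h0 (z 0) (by simpa using hzk 0) _ hnorm
        rw [Fin.cons_self_tail] at h1
        rw [hηa, h1, zero_mul, mul_zero]
      rw [setIntegral_eq_zero_of_forall_eq_zero (hface _ (by simp)),
        setIntegral_eq_zero_of_forall_eq_zero (hface _ (by simp)), sub_zero]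
  · exact fun i ↦ (continuous_const.mul ((ContinuousAlternatingMap.apply ℝ (Fin (n + 1) → ℝ) ℝ
      (i.removeNth e)).continuous.comp hηd.continuous)).continuousOn
  · intro z _ i
    exact ((ContinuousAlternatingMap.apply ℝ (Fin (n + 1) → ℝ) ℝ
      (i.removeNth e)).hasFDerivAt.comp z (hηd z).hasFDerivAt).const_smul ((-1 : ℝ) ^ (i : ℕ))
  · simp only [hz]
    exact integrableOn_zero

section AreaFormula

variable {E : Type*} [NormedAddCommGroup E] [NormedSpace ℝ E] [FiniteDimensional ℝ E]

theorem exists_injOn_of_approximatesLinearOn (A : E →L[ℝ] E) :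
    ∃ r : ℝ≥0, r ≠ 0 ∧ (A.det ≠ 0 → ∀ (f : E → E) (s : Set E),
      ApproximatesLinearOn f A s r → InjOn f s) := by
  by_cases hA : A.det = 0
  · exact ⟨1, one_ne_zero, fun h ↦ absurd hA h⟩
  set e := A.toContinuousLinearEquivOfDetNeZero hA with he
  have hcoe : (e : E →L[ℝ] E) = A := A.coe_toContinuousLinearEquivOfDetNeZero hA
  rcases e.subsingleton_or_nnnorm_symm_pos with h | h
  · exact ⟨1, one_ne_zero, fun _ f s _ x _ y _ _ ↦ Subsingleton.elim x y⟩
  · obtain ⟨r, hr0, hr⟩ := exists_between (inv_pos.2 h)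
    refine ⟨r, hr0.ne', fun _ f s hf ↦ ?_⟩
    rw [← hcoe] at hf
    exact hf.injOn (Or.inr hr)

variable [MeasurableSpace E] [BorelSpace E] (μ : Measure E) [μ.IsAddHaarMeasure]

/-- Area formula with an integer-valued multiplicity function, on a set without critical points. -/
theorem exists_multiplicity_of_det_ne_zero {f : E → E} (hf : ContDiff ℝ 1 f) {s : Set E}
    (hs : MeasurableSet s) (hb : Bornology.IsBounded s)
    (hdet : ∀ x ∈ s, (fderiv ℝ f x).det ≠ 0) :
    ∃ N : E → ℝ, Integrable N μ ∧ (∀ y, ∃ m : ℤ, N y = m) ∧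
      ∀ g : E → ℝ, Continuous g →
        ∫ x in s, |(fderiv ℝ f x).det| * g (f x) ∂μ = ∫ y, g y * N y ∂μ := by
  choose r hr0 hr using exists_injOn_of_approximatesLinearOn (E := E)
  have hder : ∀ (t : Set E), ∀ x ∈ t, HasFDerivWithinAt f (fderiv ℝ f x) t x := fun t x _ ↦
    (hf.differentiable (by simp) x).hasFDerivAt.hasFDerivWithinAt
  have hdc : Continuous fun x ↦ (fderiv ℝ f x).det :=
    ContinuousLinearMap.continuous_det.comp (hf.continuous_fderiv (by simp))
  have hdi : IntegrableOn (fun x ↦ (fderiv ℝ f x).det) s μ :=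
    (hdc.continuousOn.integrableOn_compact hb.isCompact_closure).mono_set subset_closure
  obtain ⟨t, A, htd, htm, hst, hap, hA⟩ :=
    exists_partition_approximatesLinearOn_of_hasFDerivWithinAt f s (fderiv ℝ f) (hder s) r hr0
  have hinj : ∀ n, InjOn f (s ∩ t n) := fun n ↦ by
    rcases s.eq_empty_or_nonempty with rfl | hne
    · simp
    · obtain ⟨y, hy, hAy⟩ := hA hne n
      exact hr _ (by rw [hAy]; exact hdet y hy) f _ (hap n)
  have hAm : ∀ n, MeasurableSet (s ∩ t n) := fun n ↦ hs.inter (htm n)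
  have him : ∀ n, MeasurableSet (f '' (s ∩ t n)) := fun n ↦
    (hAm n).image_of_continuousOn_injOn hf.continuous.continuousOn (hinj n)
  have hsU : s = ⋃ n, s ∩ t n := by rw [← inter_iUnion, inter_eq_left.2 hst]
  set M : E → ℝ≥0∞ := fun y ↦ ∑' n, (f '' (s ∩ t n)).indicator 1 y with hM
  have hMm : Measurable M := Measurable.tsum fun n ↦ measurable_one.indicator (him n)
  have hlint : ∀ g : E → ℝ≥0∞, Measurable g →
      ∫⁻ x in s, ENNReal.ofReal |(fderiv ℝ f x).det| * g (f x) ∂μ = ∫⁻ y, M y * g y ∂μ := by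
    intro g hg
    conv_lhs => rw [hsU]
    rw [lintegral_iUnion hAm
      (fun i j hij ↦ (htd hij).mono inter_subset_right inter_subset_right)]
    simp_rw [hM, ← ENNReal.tsum_mul_right]
    rw [lintegral_tsum (f := fun n y ↦ (f '' (s ∩ t n)).indicator 1 y * g y) fun n ↦
      ((measurable_one.indicator (him n)).mul hg).aemeasurable]
    congr 1 with n
    rw [← lintegral_image_eq_lintegral_abs_det_fderiv_mul μ (hAm n) (hder _) (hinj n),
      ← lintegral_indicator (him n)]
    congr 1 with y
    by_cases hy : y ∈ f '' (s ∩ t n) <;> simp [hy]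
  have hMfin : ∫⁻ y, M y ∂μ ≠ ⊤ := by
    have := hlint 1 measurable_one
    simp only [Pi.one_apply, mul_one] at this
    rw [← this]
    simpa [HasFiniteIntegral, Real.enorm_eq_ofReal_abs] using hdi.hasFiniteIntegral.ne
  have hmap : Measure.map f ((μ.restrict s).withDensity
      fun x ↦ ENNReal.ofReal |(fderiv ℝ f x).det|) = μ.withDensity M := by
    ext u hu
    rw [Measure.map_apply hf.continuous.measurable hu, withDensity_apply _ hu,
      withDensity_apply _ (hf.continuous.measurable hu), ← lintegral_indicator hu,
      ← lintegral_indicator (hf.continuous.measurable hu)]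
    convert hlint (u.indicator 1) (measurable_one.indicator hu) using 2
    · ext x
      by_cases hx : f x ∈ u <;> simp [hx]
    · ext x
      by_cases hx : x ∈ u <;> simp [hx]
  refine ⟨fun y ↦ (M y).toReal, integrable_toReal_of_lintegral_ne_top hMm.aemeasurable hMfin,
    fun y ↦ ?_, fun g hg ↦ ?_⟩
  · have : (M y).toReal = ∑' n, ((f '' (s ∩ t n)).indicator 1 y : ℝ) := by
      rw [hM, ENNReal.tsum_toReal_eq fun n ↦ ?_]
      · congr 1 with n
        by_cases hy : y ∈ f '' (s ∩ t n) <;> simp [hy]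
      · by_cases hy : y ∈ f '' (s ∩ t n) <;> simp [hy]
    have hmem : (M y).toReal ∈ (Int.castAddHom ℝ).range := by
      rw [this]
      refine tsum_mem Int.isClosedEmbedding_coe_real.isClosed_range fun n ↦ ?_
      by_cases hy : y ∈ f '' (s ∩ t n)
      · exact ⟨1, by simp [hy]⟩
      · exact ⟨0, by simp [hy]⟩
    obtain ⟨m, hm⟩ := hmem
    exact ⟨m, hm.symm⟩
  · have h1 : ∫ y, g y ∂(μ.withDensity M) = ∫ y, (M y).toReal • g y ∂μ :=
      integral_withDensity_eq_integral_toReal_smul hMm (ae_lt_top hMm hMfin) g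
    rw [← hmap, integral_map hf.continuous.aemeasurable hg.aestronglyMeasurable,
      integral_withDensity_eq_integral_toReal_smul hdc.abs.measurable.ennreal_ofReal (by simp)] at h1
    simpa [mul_comm] using h1

/-- Signed area formula: the Jacobian integral of `g ∘ f` is the integral of `g` against an
integer-valued function, the local degree. -/
theorem exists_integral_comp_mul_det_fderiv_eq {f : E → E} (hf : ContDiff ℝ 1 f) {s : Set E}
    (hs : MeasurableSet s) (hb : Bornology.IsBounded s) :
    ∃ N : E → ℝ, Integrable N μ ∧ (∀ y, ∃ m : ℤ, N y = m) ∧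
      ∀ g : E → ℝ, Continuous g → HasCompactSupport g →
        ∫ x in s, g (f x) * (fderiv ℝ f x).det ∂μ = ∫ y, g y * N y ∂μ := by
  have hdc : Continuous fun x ↦ (fderiv ℝ f x).det :=
    ContinuousLinearMap.continuous_det.comp (hf.continuous_fderiv (by simp))
  have hp : MeasurableSet (s ∩ {x | 0 < (fderiv ℝ f x).det}) :=
    hs.inter (isOpen_lt continuous_const hdc).measurableSet
  have hn : MeasurableSet (s ∩ {x | (fderiv ℝ f x).det < 0}) :=
    hs.inter (isOpen_lt hdc continuous_const).measurableSet
  obtain ⟨N, hNi, hN, hNg⟩ := exists_multiplicity_of_det_ne_zero μ hf hp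
    (hb.subset inter_subset_left) fun x hx ↦ (ne_of_gt hx.2)
  obtain ⟨M, hMi, hM, hMg⟩ := exists_multiplicity_of_det_ne_zero μ hf hn
    (hb.subset inter_subset_left) fun x hx ↦ (ne_of_lt hx.2)
  refine ⟨fun y ↦ N y - M y, hNi.sub hMi, fun y ↦ ?_, fun g hg hgs ↦ ?_⟩
  · obtain ⟨a, ha⟩ := hN y
    obtain ⟨b, hb⟩ := hM y
    exact ⟨a - b, by push_cast; rw [ha, hb]⟩
  · obtain ⟨C, hC⟩ := hg.bounded_above_of_compact_support hgs
    have hgi : ∀ {L : E → ℝ}, Integrable L μ → Integrable (fun y ↦ g y * L y) μ := fun hL ↦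
      hL.bdd_mul hg.aestronglyMeasurable (Filter.Eventually.of_forall hC)
    have hi : ∀ u ⊆ s, IntegrableOn (fun x ↦ |(fderiv ℝ f x).det| * g (f x)) u μ := fun u hu ↦
      (((hdc.abs.mul (hg.comp hf.continuous)).continuousOn.integrableOn_compact
        hb.isCompact_closure).mono_set subset_closure).mono_set hu
    simp only [mul_sub]
    rw [integral_sub (hgi hNi) (hgi hMi), ← hNg g hg, ← hMg g hg, ← integral_indicator hp,
      ← integral_indicator hn, ← integral_sub ((hi _ inter_subset_left).integrable_indicator hp)
        ((hi _ inter_subset_left).integrable_indicator hn), ← integral_indicator hs]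
    congr 1 with x
    by_cases hx : x ∈ s
    · rcases lt_trichotomy (fderiv ℝ f x).det 0 with h | h | h
      · simp [hx, h, h.le.not_gt, abs_of_neg h, mul_comm]
      · simp [hx, h]
      · simp [hx, h, h.le.not_gt, abs_of_pos h, mul_comm]
    · simp [hx]

end AreaFormula

/-- If `p x` is never a multiple of `x` on the unit sphere of the sup norm, then `p` has the degree
of a homothety near the origin. -/
theorem exists_integral_comp_mul_det_fderiv_eq_smul {n : ℕ} {p : (Fin n → ℝ) → Fin n → ℝ}
    (hp : ContDiff ℝ ∞ p) (h : ∀ x, ‖x‖ = 1 → ∀ c : ℝ, p x ≠ c • x) {s : ℝ} (hs : s ≠ 0) :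
    ∃ δ > 0, ∀ φ : (Fin n → ℝ) → ℝ, ContDiff ℝ ∞ φ → Function.support φ ⊆ Metric.ball 0 δ →
      ∫ x in Icc (-1 : Fin n → ℝ) 1, φ (p x) * (fderiv ℝ p x).det =
        ∫ x in Icc (-1 : Fin n → ℝ) 1, φ (s • x) * s ^ n := by
  set H : (Fin (n + 1) → ℝ) → Fin n → ℝ :=
    fun z ↦ (1 - z 0) • s • Fin.tail z + z 0 • p (Fin.tail z) with hH
  have htail : ContDiff ℝ ∞ (Fin.tail : (Fin (n + 1) → ℝ) → Fin n → ℝ) :=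
    contDiff_pi.2 fun i ↦ contDiff_apply ℝ ℝ i.succ
  have h00 : ContDiff ℝ ∞ fun z : Fin (n + 1) → ℝ ↦ z 0 := contDiff_apply ℝ ℝ 0
  have hHs : ContDiff ℝ ∞ H :=
    ((contDiff_const.sub h00).smul (htail.const_smul s)).add (h00.smul (hp.comp htail))
  set K : Set (Fin n → ℝ) := (fun q : ℝ × (Fin n → ℝ) ↦ (1 - q.1) • s • q.2 + q.1 • p q.2) ''
    (Icc (0 : ℝ) 1 ×ˢ Metric.sphere 0 1) with hK
  have hKc : IsCompact K := by
    refine (isCompact_Icc.prod (isCompact_sphere 0 1)).image ?_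
    have := hp.continuous
    fun_prop
  have hK0 : (0 : Fin n → ℝ) ∈ Kᶜ := by
    rintro ⟨⟨t, x⟩, ⟨ht, hx⟩, h0⟩
    rw [mem_sphere_zero_iff_norm] at hx
    rcases eq_or_ne t 0 with rfl | ht0
    · simp only [sub_zero, one_smul, zero_smul, add_zero, smul_eq_zero, hs, false_or] at h0
      simp [h0] at hx
    · refine h x hx (-(t⁻¹ * ((1 - t) * s))) ?_
      have h1 : t • p x = -((1 - t) • s • x) := (neg_eq_of_add_eq_zero_right h0).symm
      rw [← inv_smul_smul₀ ht0 (p x), h1, smul_neg, neg_smul, smul_smul, smul_smul, mul_assoc]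
  obtain ⟨δ, hδ, hball⟩ := Metric.isOpen_iff.1 hKc.isClosed.isOpen_compl 0 hK0
  refine ⟨δ, hδ, fun φ hφ hsupp ↦ ?_⟩
  have := integral_comp_mul_det_fderiv_eq hHs hφ fun t ht x hx ↦ by
    by_contra hne
    refine hball (hsupp hne) ⟨(t, x), ⟨ht, by simpa using hx⟩, ?_⟩
    simp [hH]
  have hlin : ∀ x : Fin n → ℝ, (fderiv ℝ (fun x : Fin n → ℝ ↦ s • x) x).det = s ^ n := fun x ↦ by
    rw [fderiv_fun_const_smul differentiableAt_fun_id, fderiv_fun_id]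
    change LinearMap.det (s • (LinearMap.id : (Fin n → ℝ) →ₗ[ℝ] (Fin n → ℝ))) = s ^ n
    simp
  simpa [hH, hlin] using this

theorem setIntegral_contDiffBump_pos {n : ℕ} (φ : ContDiffBump (0 : Fin n → ℝ)) (hφ : φ.rOut ≤ 1) :
    0 < ∫ x in Icc (-1 : Fin n → ℝ) 1, φ x := by
  rw [setIntegral_eq_integral_of_forall_compl_eq_zero]
  · exact φ.integral_pos
  · intro x hx
    refine φ.zero_of_le_dist (hφ.trans ?_)
    by_contra! hlt
    rw [dist_zero_right, pi_norm_lt_iff one_pos] at hlt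
    exact hx ⟨fun i ↦ (abs_lt.1 (hlt i)).1.le, fun i ↦ (abs_lt.1 (hlt i)).2.le⟩

/-- A smooth form of the hairy ball theorem. -/
theorem exists_eq_smul_of_odd_of_contDiff {n : ℕ} (hn : Odd n) {p : (Fin n → ℝ) → Fin n → ℝ}
    (hp : ContDiff ℝ ∞ p) : ∃ x, ‖x‖ = 1 ∧ ∃ c : ℝ, p x = c • x := by
  by_contra! h
  obtain ⟨δ, hδ, h1⟩ := exists_integral_comp_mul_det_fderiv_eq_smul hp h one_ne_zero
  obtain ⟨ε, hε, h2⟩ := exists_integral_comp_mul_det_fderiv_eq_smul hp h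
    (neg_ne_zero.2 one_ne_zero)
  obtain ⟨r, hr0, hr⟩ := exists_between (lt_min (lt_min hδ hε) one_pos)
  obtain ⟨⟨hrδ, hrε⟩, hr1⟩ := (by simpa only [lt_min_iff] using hr : (r < δ ∧ r < ε) ∧ r < 1)
  let φ : ContDiffBump (0 : Fin n → ℝ) := ⟨r / 2, r, half_pos hr0, half_lt_self hr0⟩
  have hpos := setIntegral_contDiffBump_pos φ hr1.le
  have e1 := h1 φ φ.contDiff (by rw [φ.support_eq]; exact Metric.ball_subset_ball hrδ.le)
  have e2 := h2 φ φ.contDiff (by rw [φ.support_eq]; exact Metric.ball_subset_ball hrε.le)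
  rw [e1] at e2
  simp only [one_smul, one_pow, mul_one, neg_smul, φ.neg, hn.neg_one_pow, mul_neg,
    integral_neg] at e2
  linarith

theorem exists_eq_smul_of_even_of_contDiff {n : ℕ} (hn : 0 < n) {p : (Fin n → ℝ) → Fin n → ℝ}
    (hp : ContDiff ℝ ∞ p) (heven : ∀ x, p (-x) = p x) :
    ∃ x, ‖x‖ = 1 ∧ ∃ c : ℝ, p x = c • x := by
  rcases Nat.even_or_odd n with hne | hno
  swap
  · exact exists_eq_smul_of_odd_of_contDiff hno hp
  by_contra! h
  obtain ⟨δ, hδ, h1⟩ := exists_integral_comp_mul_det_fderiv_eq_smul hp h one_ne_zero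
  set i0 : Fin n := ⟨0, hn⟩
  set Q : Set (Fin n → ℝ) := Icc (-1) 1 with hQ
  set P : Set (Fin n → ℝ) := {x | 0 < x i0} with hP
  have hPm : MeasurableSet P := (isOpen_lt continuous_const (continuous_apply i0)).measurableSet
  have hPc : (Pᶜ : Set (Fin n → ℝ)) =ᵐ[volume] -P := by
    have h0 : ∀ᵐ x : Fin n → ℝ, x i0 ≠ 0 := by
      have := Measure.pi_hyperplane (fun _ : Fin n ↦ (volume : Measure ℝ)) i0 0
      rw [ae_iff]
      simpa [volume_pi] using this
    filter_upwards [h0] with x hx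
    refine propext ⟨fun hxP ↦ ?_, fun hxP ↦ ?_⟩
    · change 0 < -x i0
      have : x i0 ≤ 0 := not_lt.1 hxP
      linarith [lt_of_le_of_ne this hx]
    · change ¬ 0 < x i0
      have : 0 < -x i0 := hxP
      linarith
  have hder : ∀ x, (fderiv ℝ p (-x)).det = (fderiv ℝ p x).det := fun x ↦ by
    have h2 : fderiv ℝ p (-x) = -fderiv ℝ p x := by
      have := fderiv_comp_smul (f := p) (x := x) (-1 : ℝ)
      simp only [neg_one_smul, heven] at this
      rw [this, neg_neg]
    rw [h2]
    change LinearMap.det (-(fderiv ℝ p x : (Fin n → ℝ) →ₗ[ℝ] (Fin n → ℝ))) = _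
    rw [← neg_one_smul ℝ, LinearMap.det_smul, Module.finrank_fin_fun, hne.neg_one_pow, one_mul]
  have hdc : Continuous fun x ↦ (fderiv ℝ p x).det :=
    ContinuousLinearMap.continuous_det.comp (hp.continuous_fderiv (by simp))
  obtain ⟨N, hNi, hN, hNg⟩ := exists_integral_comp_mul_det_fderiv_eq
    (volume : Measure (Fin n → ℝ)) (hp.of_le (by exact WithTop.coe_le_coe.2 le_top))
    (measurableSet_Icc.inter hPm : MeasurableSet (Q ∩ P))
    ((Metric.isBounded_Icc _ _).subset inter_subset_left)
  have hdouble : ∀ φ : (Fin n → ℝ) → ℝ, Continuous φ →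
      ∫ x in Q, φ (p x) * (fderiv ℝ p x).det =
        2 * ∫ x in Q ∩ P, φ (p x) * (fderiv ℝ p x).det := by
    intro φ hφ
    set F : (Fin n → ℝ) → ℝ := fun x ↦ φ (p x) * (fderiv ℝ p x).det with hF
    have hFc : Continuous F := (hφ.comp hp.continuous).mul hdc
    have hFn : ∀ x, F (-x) = F x := fun x ↦ by simp only [hF, heven, hder]
    have hFQ : IntegrableOn F Q := hFc.continuousOn.integrableOn_compact isCompact_Icc
    have hrefl : ∫ x in Q ∩ -P, F x = ∫ x in Q ∩ P, F x := by
      rw [← integral_indicator (measurableSet_Icc.inter hPm.neg),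
        ← integral_indicator (measurableSet_Icc.inter hPm), ← integral_neg_eq_self]
      congr 1 with x
      have hQx : -x ∈ Q ↔ x ∈ Q := by
        simp only [hQ, mem_Icc, neg_le_neg_iff, neg_le (a := x), and_comm]
      by_cases hx : x ∈ Q ∩ P
      · rw [indicator_of_mem hx, indicator_of_mem, hFn]
        exact ⟨hQx.2 hx.1, by simpa using hx.2⟩
      · rw [indicator_of_notMem hx, indicator_of_notMem]
        exact fun h ↦ hx ⟨hQx.1 h.1, by simpa using h.2⟩
    rw [← integral_inter_add_sdiff hPm hFQ, Set.sdiff_eq, setIntegral_congr_set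
      ((Filter.EventuallyEq.refl _ Q).inter hPc), hrefl, two_mul]
  have hball : ∀ x ∈ Metric.ball (0 : Fin n → ℝ) 1, x ∈ Q := fun x hx ↦ by
    rw [mem_ball_zero_iff, pi_norm_lt_iff one_pos] at hx
    exact ⟨fun i ↦ (abs_lt.1 (hx i)).1.le, fun i ↦ (abs_lt.1 (hx i)).2.le⟩
  have hopen : IsOpen (Metric.ball (0 : Fin n → ℝ) (min δ 1)) := Metric.isOpen_ball
  have hae := hopen.ae_eq_zero_of_integral_contDiff_smul_eq_zero (μ := volume) (f := fun y ↦ 2 * N y - 1)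
    (((hNi.const_mul 2).locallyIntegrable.sub (locallyIntegrable_const 1)).locallyIntegrableOn _) (by
      intro g hg hgs hgt
      have hgb := (subset_tsupport g).trans hgt
      have e1 := h1 g hg (hgb.trans (Metric.ball_subset_ball (min_le_left _ _)))
      rw [hdouble g hg.continuous, hNg g hg.continuous hgs] at e1
      simp only [one_smul, one_pow, mul_one] at e1
      rw [setIntegral_eq_integral_of_forall_compl_eq_zero] at e1
      · have hgi : Integrable g := hg.continuous.integrable_of_hasCompactSupport hgs
        obtain ⟨C, hC⟩ := hg.continuous.bounded_above_of_compact_support hgs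
        have hgN : Integrable fun y ↦ g y * N y :=
          hNi.bdd_mul hg.continuous.aestronglyMeasurable (Filter.Eventually.of_forall hC)
        have : ∀ y, g y • (2 * N y - 1) = 2 * (g y * N y) - g y := fun y ↦ by
          rw [smul_eq_mul]; ring
        simp only [this]
        rw [integral_sub (hgN.const_mul 2) hgi, integral_const_mul, e1, sub_self]
      · intro x hx
        by_contra hne
        exact hx (hball x (Metric.ball_subset_ball (min_le_right _ _) (hgb hne))))
  have hpos : 0 < volume (Metric.ball (0 : Fin n → ℝ) (min δ 1)) :=
    Metric.measure_ball_pos _ _ (lt_min hδ one_pos)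
  obtain ⟨y, hy, hy0⟩ : ∃ y ∈ Metric.ball (0 : Fin n → ℝ) (min δ 1), 2 * N y - 1 = 0 := by
    by_contra! hcon
    refine hpos.ne' (measure_mono_null (fun y hy ↦ ?_) (ae_iff.1 hae))
    exact fun himp ↦ hcon y hy (himp hy)
  obtain ⟨m, hm⟩ := hN y
  rw [hm] at hy0
  have : 2 * m - 1 = 0 := by exact_mod_cast hy0
  omega

theorem exists_eq_smul_of_approx {V : Type*} [NormedAddCommGroup V] [NormedSpace ℝ V]
    [FiniteDimensional ℝ V] {f : V → V} (hf : Continuous f)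
    (h : ∀ ε > 0, ∃ p : V → V, (∀ x, dist (p x) (f x) < ε) ∧ ∃ x, ‖x‖ = 1 ∧ ∃ c : ℝ, p x = c • x) :
    ∃ x, ‖x‖ = 1 ∧ ∃ c : ℝ, f x = c • x := by
  have : ProperSpace V := FiniteDimensional.proper ℝ V
  by_contra! hcon
  obtain ⟨M, hM⟩ := (isCompact_sphere (0 : V) 1).exists_bound_of_continuousOn hf.continuousOn
  have hK := ((isCompact_sphere (0 : V) 1).prod (isCompact_Icc (a := -(M + 1)) (b := M + 1))).image
    (f := fun q : V × ℝ ↦ f q.1 - q.2 • q.1) (by fun_prop)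
  obtain ⟨δ, hδ, hball⟩ := Metric.isOpen_iff.1 hK.isClosed.isOpen_compl 0 (by
    rintro ⟨⟨x, c⟩, ⟨hx, -⟩, h0⟩
    exact hcon x (by simpa using hx) c (sub_eq_zero.1 h0))
  obtain ⟨p, hp, x, hx, c, hc⟩ := h (min δ 1) (lt_min hδ one_pos)
  have hpx : ‖p x - f x‖ < δ ∧ ‖p x - f x‖ < 1 := by simpa [dist_eq_norm] using hp x
  have hcM : |c| ≤ M + 1 := by
    have h1 : ‖p x‖ = |c| := by rw [hc, norm_smul, hx, mul_one, Real.norm_eq_abs]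
    have h2 := norm_le_norm_add_norm_sub' (p x) (f x)
    have h3 := hM x (by simpa using hx)
    linarith [hpx.2]
  have hmem : f x - c • x ∈ Metric.ball 0 δ := by
    rw [mem_ball_zero_iff, ← hc, norm_sub_rev]
    exact hpx.1
  exact hball hmem ⟨(x, c), ⟨by simpa using hx, abs_le.1 hcM⟩, rfl⟩

theorem exists_eq_smul_of_odd_of_continuous {n : ℕ} (hn : Odd n) {f : (Fin n → ℝ) → Fin n → ℝ}
    (hf : Continuous f) : ∃ x, ‖x‖ = 1 ∧ ∃ c : ℝ, f x = c • x := by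
  refine exists_eq_smul_of_approx hf fun ε hε ↦ ?_
  obtain ⟨p, hp, hd, -⟩ := hf.exists_contDiff_approx ⊤ (ε := fun _ ↦ ε) continuous_const fun _ ↦ hε
  exact ⟨p, hd, exists_eq_smul_of_odd_of_contDiff hn hp⟩

theorem exists_eq_smul_of_even_of_continuous {n : ℕ} (hn : 0 < n)
    {f : (Fin n → ℝ) → Fin n → ℝ} (hf : Continuous f) (heven : ∀ x, f (-x) = f x) :
    ∃ x, ‖x‖ = 1 ∧ ∃ c : ℝ, f x = c • x := by
  refine exists_eq_smul_of_approx hf fun ε hε ↦ ?_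
  obtain ⟨p, hp, hd, -⟩ := hf.exists_contDiff_approx ⊤ (ε := fun _ ↦ ε) continuous_const fun _ ↦ hε
  refine ⟨fun x ↦ midpoint ℝ (p x) (p (-x)), fun x ↦ ?_,
    exists_eq_smul_of_even_of_contDiff hn ?_ fun x ↦ ?_⟩
  · have h1 := dist_midpoint_midpoint_le (p x) (p (-x)) (f x) (f x)
    have h2 := hd (-x)
    rw [heven] at h2
    rw [midpoint_self] at h1
    linarith [hd x]
  · simp only [midpoint_eq_smul_add]
    exact (hp.add (hp.comp contDiff_neg)).const_smul _
  · simp only [neg_neg]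
    exact midpoint_comm _ _

section FiniteDimensional

variable {E : Type*} [NormedAddCommGroup E] [NormedSpace ℝ E]

/-- A continuous self-map of `Fin n → ℝ` that agrees with a conjugate of `f` on the unit sphere. -/
theorem exists_continuous_eq_conj_on_sphere {n : ℕ} (e : E ≃L[ℝ] (Fin n → ℝ)) {f : E → E}
    (hf : ContinuousOn f {0}ᶜ) :
    ∃ F : (Fin n → ℝ) → Fin n → ℝ, Continuous F ∧ ∀ x, ‖x‖ = 1 → F x = e (f (e.symm x)) := by
  have hc : ContinuousOn (fun x ↦ e (f (e.symm x))) (Metric.sphere 0 1) := by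
    refine e.continuous.comp_continuousOn (hf.comp e.symm.continuous.continuousOn fun x hx ↦ ?_)
    rw [mem_sphere_zero_iff_norm] at hx
    simp only [mem_compl_iff, mem_singleton_iff, EmbeddingLike.map_eq_zero_iff]
    rintro rfl
    simp at hx
  obtain ⟨F, hF⟩ := ContinuousMap.exists_restrict_eq Metric.isClosed_sphere
    (⟨_, hc.domRestrict⟩ : C(Metric.sphere (0 : Fin n → ℝ) 1, Fin n → ℝ))
  exact ⟨F, F.continuous, fun x hx ↦ congrArg (fun G ↦ G ⟨x, by simpa using hx⟩) hF⟩

theorem exists_eq_smul_of_conj {n : ℕ} (e : E ≃L[ℝ] (Fin n → ℝ)) {f : E → E}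
    (h : ∃ x, ‖x‖ = 1 ∧ ∃ c : ℝ, e (f (e.symm x)) = c • x) : ∃ x ≠ 0, ∃ c : ℝ, f x = c • x := by
  obtain ⟨x, hx, c, hc⟩ := h
  refine ⟨e.symm x, ?_, c, e.injective (by simp [hc])⟩
  rw [Ne, EmbeddingLike.map_eq_zero_iff]
  rintro rfl
  simp at hx

variable [FiniteDimensional ℝ E]

/-- **Hairy ball theorem**: in odd dimension, a continuous field on `E \ {0}` is radial
somewhere. -/
theorem exists_eq_smul_of_odd_finrank (hn : Odd (Module.finrank ℝ E)) {f : E → E}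
    (hf : ContinuousOn f {0}ᶜ) : ∃ x ≠ 0, ∃ c : ℝ, f x = c • x := by
  let e := ContinuousLinearEquiv.ofFinrankEq (𝕜 := ℝ) (E := E) (F := Fin (Module.finrank ℝ E) → ℝ)
    (by simp)
  obtain ⟨F, hF, hFe⟩ := exists_continuous_eq_conj_on_sphere e hf
  obtain ⟨x, hx, c, hc⟩ := exists_eq_smul_of_odd_of_continuous hn hF
  exact exists_eq_smul_of_conj e ⟨x, hx, c, by rw [← hFe x hx, hc]⟩

/-- In positive dimension, an even continuous field on `E \ {0}` is radial somewhere. -/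
theorem exists_eq_smul_of_even (hn : 0 < Module.finrank ℝ E) {f : E → E}
    (hf : ContinuousOn f {0}ᶜ) (heven : ∀ x, f (-x) = f x) : ∃ x ≠ 0, ∃ c : ℝ, f x = c • x := by
  let e := ContinuousLinearEquiv.ofFinrankEq (𝕜 := ℝ) (E := E) (F := Fin (Module.finrank ℝ E) → ℝ)
    (by simp)
  obtain ⟨F, hF, hFe⟩ := exists_continuous_eq_conj_on_sphere e hf
  obtain ⟨x, hx, c, hc⟩ := exists_eq_smul_of_even_of_continuous hn
    (f := fun x ↦ midpoint ℝ (F x) (F (-x)))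
    (by simp only [midpoint_eq_smul_add]; fun_prop)
    fun x ↦ by rw [neg_neg]; exact midpoint_comm _ _
  refine exists_eq_smul_of_conj e ⟨x, hx, c, ?_⟩
  have hx' : ‖-x‖ = 1 := by rwa [norm_neg]
  rw [← hc, hFe x hx, hFe _ hx', map_neg, heven, midpoint_self]

end FiniteDimensional

section LieGroup

variable {E : Type*} [NormedAddCommGroup E] [NormedSpace ℝ E]
  {H : Type*} [TopologicalSpace H] {I : ModelWithCorners ℝ E H}
  {G : Type*} [TopologicalSpace G] [ChartedSpace H G] [Group G] [LieGroup I ∞ G]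

theorem isMIntegralCurve_mul_left {v : GroupLieAlgebra I G} {γ : ℝ → G}
    (hγ : IsMIntegralCurve γ (mulInvariantVectorField (I := I) v)) (g : G) :
    IsMIntegralCurve (fun t ↦ g * γ t) (mulInvariantVectorField (I := I) v) := by
  intro t
  have h2 : HasMFDerivAt I I (g * ·) (γ t) (mfderiv I I (g * ·) (γ t)) :=
    ((contMDiff_mul_left (I := I) (n := ∞)).contMDiffAt.mdifferentiableAt (by simp)).hasMFDerivAt
  refine (h2.comp t (hγ t)).congr_mfderiv (ContinuousLinearMap.ext fun (s : ℝ) ↦ ?_)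
  change mfderiv I I (g * ·) (γ t) (s • mulInvariantVectorField v (γ t)) =
    s • mulInvariantVectorField v (g * γ t)
  rw [map_smul, mfderiv_mulInvariantVectorField]

variable [FiniteDimensional ℝ E] [I.Boundaryless] [T2Space G]

theorem lieExp_smul_eq {v : GroupLieAlgebra I G} {γ : ℝ → G} (h0 : γ 0 = 1)
    (hγ : IsMIntegralCurve γ (mulInvariantVectorField (I := I) v)) (t : ℝ) :
    lieExp (t • v) = γ t := by
  have h := hγ.comp_mul t
  rw [← mulInvariantVectorField_smul] at h
  rw [lieExp_eq (t • v) _ (by simp [h0]) h]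
  simp

theorem lieExp_add_smul (v : GroupLieAlgebra I G) (s t : ℝ) :
    lieExp ((s + t) • v) = lieExp (s • v) * lieExp (t • v) := by
  have : CompleteSpace E := FiniteDimensional.complete ℝ E
  have : IsManifold I 1 G := isManifold_one
  obtain ⟨γ, h0, hγ⟩ := exists_integralCurve v
  simp only [lieExp_smul_eq h0 hγ]
  have h := isMIntegralCurve_Ioo_eq_of_contMDiff_boundaryless (t₀ := 0)
    (contMDiff_leftInvariant v) (hγ.comp_add s) (isMIntegralCurve_mul_left hγ (γ s)) (by simp [h0])
  simpa [add_comm] using congrFun h t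

theorem lieExp_zero : lieExp (0 : GroupLieAlgebra I G) = 1 := by
  simpa using lieExp_add_smul (0 : GroupLieAlgebra I G) 0 0

theorem lieExp_neg (v : GroupLieAlgebra I G) : lieExp (-v) = (lieExp v)⁻¹ := by
  refine (inv_eq_of_mul_eq_one_right ?_).symm
  simpa [lieExp_zero] using (lieExp_add_smul v 1 (-1)).symm

theorem lieExp_nat_smul (v : GroupLieAlgebra I G) (k : ℕ) :
    lieExp ((k : ℝ) • v) = lieExp v ^ k := by
  induction k with
  | zero => simp [lieExp_zero]
  | succ k ih => rw [Nat.cast_succ, lieExp_add_smul, ih, one_smul, pow_succ]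

/-- The exponential map is continuous as soon as it is continuous near the origin. -/
theorem continuous_lieExp {φ : OpenPartialHomeomorph E G} (h0 : 0 ∈ φ.source)
    (hφ : ∀ v ∈ φ.source, φ v = lieExp (I := I) (G := G) v) :
    Continuous fun v : E ↦ lieExp (I := I) (G := G) v := by
  have : IsTopologicalGroup G := topologicalGroup_of_lieGroup I ∞
  rw [continuous_iff_continuousAt]
  intro v
  have hlim : Filter.Tendsto (fun k : ℕ ↦ ((k : ℝ)⁻¹) • v) Filter.atTop (nhds 0) := by
    simpa using (tendsto_inv_atTop_nhds_zero_nat (𝕜 := ℝ)).smul_const v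
  obtain ⟨k, hk, hk0⟩ := ((hlim.eventually (φ.open_source.mem_nhds h0)).and
    (Filter.eventually_gt_atTop 0)).exists
  have hk' : (k : ℝ) ≠ 0 := by positivity
  have hsc : ContinuousAt (fun w : E ↦ ((k : ℝ)⁻¹) • w) v := by fun_prop
  have hc : ContinuousAt (fun w : E ↦ φ (((k : ℝ)⁻¹) • w) ^ k) v :=
    ContinuousAt.pow (ContinuousAt.comp (φ.continuousAt hk) hsc) k
  refine hc.congr ?_
  filter_upwards [hsc.eventually (φ.open_source.mem_nhds hk)] with w hw
  have hpow : lieExp (I := I) (G := G) ((k : ℝ) • (k : ℝ)⁻¹ • w : E) = φ ((k : ℝ)⁻¹ • w) ^ k :=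
    (lieExp_nat_smul (I := I) (G := G) _ k).trans (by rw [hφ _ hw])
  rw [← hpow, smul_inv_smul₀ hk']

/-- The underlying space of a taut configuration, with lines parametrized by nonzero vectors. -/
theorem taut_of_exists_eq_smul [MeasurableSpace G] [BorelSpace G]
    {s : E → G} (hs : ContinuousOn s {0}ᶜ) (hhom : ∀ c : ℝ, 0 < c → ∀ x, s (c • x) = s x)
    {φ : OpenPartialHomeomorph E G} (h0 : 0 ∈ φ.source)
    (hφ : ∀ v ∈ φ.source, φ v = lieExp (I := I) (G := G) v)
    (hsφ : ∀ x ≠ 0, s x ∈ φ.target)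
    (hfix : ∀ F : G → E, ContinuousOn (fun x ↦ F (s x)) {0}ᶜ → ∃ x ≠ 0, ∃ c : ℝ, F (s x) = c • x)
    {S : Set G}
    (hS : S = {g | ∃ x : E, x ≠ 0 ∧ ∃ t : ℝ, s x * lieExp (I := I) (G := G) (t • x : E) = g}) :
    (∃ W : Set G, IsOpen W ∧ 1 ∈ W ∧ W ⊆ S) ∧ MeasurableSet S ∧
      ∀ μ : Measure G, μ.IsHaarMeasure → 0 < μ S := by
  have : IsTopologicalGroup G := topologicalGroup_of_lieGroup I ∞
  have : ProperSpace E := FiniteDimensional.proper ℝ E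
  have hexp := continuous_lieExp (I := I) h0 hφ
  have hsph : Metric.sphere (0 : E) 1 ⊆ {0}ᶜ := fun x hx ↦ by
    rintro rfl
    simp at hx
  have hunit : ∀ x : E, x ≠ 0 → ‖x‖⁻¹ • x ∈ Metric.sphere (0 : E) 1 := fun x hx ↦ by
    simp [norm_smul, hx]
  set K := s '' Metric.sphere 0 1 with hK
  have hKc : IsCompact K := (isCompact_sphere 0 1).image_of_continuousOn (hs.mono hsph)
  have hsK : ∀ x ≠ 0, s x ∈ K := fun x hx ↦
    ⟨_, hunit x hx, hhom _ (inv_pos.2 (norm_pos_iff.2 hx)) x⟩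
  have hW : ∃ W : Set G, IsOpen W ∧ 1 ∈ W ∧ W ⊆ S := by
    obtain ⟨u, v, huo, -, h1u, hKv, huv⟩ := generalized_tube_lemma (isCompact_singleton (x := (1 : G)))
      hKc (n := (fun q : G × G ↦ q.1⁻¹ * q.2) ⁻¹' φ.target)
      (φ.open_target.preimage (by fun_prop)) (by
        rintro ⟨a, b⟩ ⟨rfl, x, hx, rfl⟩
        simpa using hsφ x (hsph hx))
    refine ⟨u, huo, h1u rfl, fun g hg ↦ ?_⟩
    have hmem : ∀ x ≠ 0, g⁻¹ * s x ∈ φ.target := fun x hx ↦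
      huv (mk_mem_prod hg (hKv (hsK x hx)))
    obtain ⟨x, hx, c, hc⟩ := hfix (fun k ↦ φ.symm (g⁻¹ * k))
      (φ.continuousOn_symm.comp (continuousOn_const.mul hs) hmem)
    rw [hS]
    refine ⟨x, hx, -c, ?_⟩
    have h2 : lieExp (I := I) (G := G) (c • x : E) = g⁻¹ * s x := by
      rw [← hc, ← hφ _ (φ.map_target (hmem x hx)), φ.right_inv (hmem x hx)]
    have h3 : lieExp (I := I) (G := G) (-(c • x) : E) = (g⁻¹ * s x)⁻¹ :=
      (lieExp_neg (I := I) (G := G) _).trans (by rw [h2])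
    rw [neg_smul, h3]
    group
  refine ⟨hW, ?_, fun μ hμ ↦ ?_⟩
  · have hU : S = ⋃ m : ℕ, (fun q : E × ℝ ↦ s q.1 * lieExp (I := I) (G := G) (q.2 • q.1 : E)) ''
        (Metric.sphere 0 1 ×ˢ Icc (-m : ℝ) m) := by
      rw [hS]
      ext g
      simp only [mem_ofPred_eq, mem_iUnion]
      constructor
      · rintro ⟨x, hx, t, rfl⟩
        obtain ⟨m, hm⟩ := exists_nat_ge |t * ‖x‖|
        refine ⟨m, (‖x‖⁻¹ • x, t * ‖x‖), ⟨hunit x hx, abs_le.1 hm⟩, ?_⟩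
        have : ‖x‖ ≠ 0 := norm_ne_zero_iff.2 hx
        simp only [hhom _ (inv_pos.2 (norm_pos_iff.2 hx)) x]
        rw [smul_smul, mul_assoc, mul_inv_cancel₀ this, mul_one]
      · rintro ⟨m, ⟨x, t⟩, ⟨hx, -⟩, rfl⟩
        exact ⟨x, hsph hx, t, rfl⟩
    rw [hU]
    refine MeasurableSet.iUnion fun m ↦ (((isCompact_sphere 0 1).prod
      isCompact_Icc).image_of_continuousOn ?_).measurableSet
    exact (hs.comp continuousOn_fst fun q hq ↦ hsph hq.1).mul
      (hexp.comp (continuous_snd.smul continuous_fst)).continuousOn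
  · obtain ⟨W, hWo, h1W, hWS⟩ := hW
    exact (hWo.measure_pos μ ⟨1, h1W⟩).trans_le (measure_mono hWS)

end LieGroup

section InnerProduct

variable {V : Type*} [NormedAddCommGroup V] [NormedSpace ℝ V]

theorem inner_smul_smul_of_core (B : InnerProductSpace.Core ℝ V) (c : ℝ) (v : V) :
    B.inner (c • v) (c • v) = c ^ 2 * B.inner v v := by
  have h : B.inner v (c • v) = c * B.inner v v := by
    rw [← B.conj_inner_symm, B.smul_left]
    simp
  rw [B.smul_left, h]
  simp [sq, mul_assoc]

theorem inner_self_pos_of_core (B : InnerProductSpace.Core ℝ V) {v : V} (hv : v ≠ 0) :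
    0 < B.inner v v :=
  lt_of_le_of_ne (by simpa using B.re_inner_nonneg v) fun h ↦ hv (B.definite v h.symm)

theorem inv_sqrt_smul_mem_unitSphere (B : InnerProductSpace.Core ℝ V) {v : V} (hv : v ≠ 0) :
    (√(B.inner v v))⁻¹ • v ∈ unitSphere B := by
  have h := inner_self_pos_of_core B hv
  change B.inner _ _ = 1
  rw [inner_smul_smul_of_core, inv_pow, Real.sq_sqrt h.le, inv_mul_cancel₀ h.ne']

theorem ne_zero_of_mem_unitSphere (B : InnerProductSpace.Core ℝ V) {v : V}
    (hv : v ∈ unitSphere B) : v ≠ 0 := by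
  rintro rfl
  have h := inner_smul_smul_of_core B 0 0
  have h1 : B.inner 0 0 = 1 := hv
  simp [h1] at h

/-- The radial retraction onto the unit sphere of `B`. -/
def toUnitSphere (B : InnerProductSpace.Core ℝ V) (v : {v : V // v ≠ 0}) : unitSphere B :=
  ⟨(√(B.inner v.1 v.1))⁻¹ • v.1, inv_sqrt_smul_mem_unitSphere B v.2⟩

theorem toUnitSphere_smul (B : InnerProductSpace.Core ℝ V) {c : ℝ} (hc : 0 < c)
    {v : V} (hv : v ≠ 0) :
    toUnitSphere B ⟨c • v, smul_ne_zero hc.ne' hv⟩ = toUnitSphere B ⟨v, hv⟩ := by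
  refine Subtype.ext ?_
  simp only [toUnitSphere, inner_smul_smul_of_core]
  rw [Real.sqrt_mul (sq_nonneg c), Real.sqrt_sq hc.le, smul_smul]
  congr 1
  field_simp

theorem toUnitSphere_of_mem (B : InnerProductSpace.Core ℝ V) {v : V} (hv : v ∈ unitSphere B) :
    toUnitSphere B ⟨v, ne_zero_of_mem_unitSphere B hv⟩ = ⟨v, hv⟩ := by
  refine Subtype.ext ?_
  have h : B.inner v v = 1 := hv
  simp [toUnitSphere, h]

variable [FiniteDimensional ℝ V]

theorem continuous_inner_self_of_core (B : InnerProductSpace.Core ℝ V) :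
    Continuous fun v : V ↦ B.inner v v := by
  let L : V →ₗ[ℝ] V →ₗ[ℝ] ℝ := LinearMap.mk₂ ℝ (fun v w ↦ B.inner w v)
    (fun v w x ↦ by
      rw [← B.conj_inner_symm, B.add_left, map_add, B.conj_inner_symm, B.conj_inner_symm])
    (fun c v w ↦ by
      rw [← B.conj_inner_symm, B.smul_left, map_mul, B.conj_inner_symm]; simp)
    (fun v w x ↦ B.add_left w x v)
    (fun c v w ↦ by simpa using B.smul_left w v c)
  let L' : V →ₗ[ℝ] V →L[ℝ] ℝ := LinearMap.toContinuousLinearMap.toLinearMap ∘ₗ L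
  exact L'.continuous_of_finiteDimensional.clm_apply continuous_id

theorem continuous_toUnitSphere (B : InnerProductSpace.Core ℝ V) : Continuous (toUnitSphere B) := by
  refine Continuous.subtype_mk (Continuous.smul (Continuous.inv₀ ?_ fun v ↦ ?_)
    continuous_subtype_val) _
  · exact ((continuous_inner_self_of_core B).comp continuous_subtype_val).sqrt
  · exact (Real.sqrt_pos.2 (inner_self_pos_of_core B v.2)).ne'

end InnerProduct

open scoped Classical in
theorem continuousOn_dite_ne_zero {V X : Type*} [TopologicalSpace V] [Zero V] [TopologicalSpace X]
    {f : {v : V // v ≠ 0} → X} (hf : Continuous f) (a : X) :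
    ContinuousOn (fun v ↦ if h : v ≠ 0 then f ⟨v, h⟩ else a) {0}ᶜ := by
  rw [continuousOn_iff_continuous_domRestrict]
  exact (hf.comp (continuous_subtype_val.subtype_mk fun v : ({0}ᶜ : Set V) ↦ v.2)).congr
    fun v ↦ by
      have hv : (v : V) ≠ 0 := v.2
      simp only [domRestrict_apply, dif_pos hv]
      rfl

section Configurations

variable {E : Type*} [NormedAddCommGroup E] [NormedSpace ℝ E] [FiniteDimensional ℝ E]
  {H : Type*} [TopologicalSpace H] (I : ModelWithCorners ℝ E H) [I.Boundaryless]
  {G : Type*} [TopologicalSpace G] [ChartedSpace H G] [Group G] [LieGroup I ∞ G]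
  [T2Space G] [MeasurableSpace G] [BorelSpace G]

theorem taut_unoriented (hn : 0 < Module.finrank ℝ E) (σ : ℙ ℝ (GroupLieAlgebra I G) → G)
    (hσ : Continuous σ) (htaut : IsTaut I σ) :
    (∃ W : Set G, IsOpen W ∧ 1 ∈ W ∧ W ⊆ unorientedSpace I σ) ∧
      MeasurableSet (unorientedSpace I σ) ∧
      ∀ μ : Measure G, μ.IsHaarMeasure → 0 < μ (unorientedSpace I σ) := by
  classical
  obtain ⟨φ, h0, -, hφ, -, -, hr⟩ := htaut
  set s : E → G := fun v ↦ if h : v ≠ 0 then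
    σ (Projectivization.mk' ℝ (⟨v, h⟩ : {v : GroupLieAlgebra I G // v ≠ 0})) else 1 with hs
  have hsv : ∀ v (h : v ≠ 0),
      s v = σ (Projectivization.mk' ℝ (⟨v, h⟩ : {v : GroupLieAlgebra I G // v ≠ 0})) :=
    fun v h ↦ dif_pos h
  have hsm : ∀ c : ℝ, c ≠ 0 → ∀ x, s (c • x) = s x := fun c hc x ↦ by
    by_cases hx : x = 0
    · simp [hx]
    · rw [hsv _ (smul_ne_zero hc hx), hsv x hx]
      congr 1
      exact (Projectivization.mk_eq_mk_iff' ℝ _ _ _ _).2 ⟨c, rfl⟩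
  refine taut_of_exists_eq_smul (I := I) (s := s)
    (continuousOn_dite_ne_zero (V := E) (hσ.comp continuous_coinduced_rng) 1)
    (fun c hc ↦ hsm c hc.ne') h0 hφ (fun x hx ↦ hr ⟨_, (hsv x hx).symm⟩)
    (fun F hF ↦ exists_eq_smul_of_even hn hF fun x ↦ ?_) ?_
  · rw [← neg_one_smul ℝ, hsm _ (neg_ne_zero.2 one_ne_zero)]
  · ext g
    simp only [unorientedSpace, mem_iUnion, mem_ofPred_eq]
    constructor
    · rintro ⟨L, v, hv, rfl⟩
      induction L using Projectivization.ind with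
      | h x hx =>
        obtain ⟨t, rfl⟩ := Submodule.mem_span_singleton.1 hv
        exact ⟨x, hx, t, by rw [hsv x hx]; rfl⟩
    · rintro ⟨x, hx, t, rfl⟩
      exact ⟨Projectivization.mk ℝ (x : GroupLieAlgebra I G) hx, (t • x : E),
        Submodule.mem_span_singleton.2 ⟨t, rfl⟩, by rw [hsv x hx]; rfl⟩

theorem taut_oriented (hn : Odd (Module.finrank ℝ E))
    (B : InnerProductSpace.Core ℝ E) (σ : unitSphere B → G)
    (hσ : Continuous σ) (htaut : IsTaut I σ) :
    (∃ W : Set G, IsOpen W ∧ 1 ∈ W ∧ W ⊆ orientedSpace I (G := G) B σ) ∧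
      MeasurableSet (orientedSpace I (G := G) B σ) ∧
      ∀ μ : Measure G, μ.IsHaarMeasure → 0 < μ (orientedSpace I (G := G) B σ) := by
  classical
  obtain ⟨φ, h0, -, hφ, -, -, hr⟩ := htaut
  set s : E → G := fun v ↦ if h : v ≠ 0 then σ (toUnitSphere B ⟨v, h⟩) else 1 with hs
  have hsv : ∀ v (h : v ≠ 0), s v = σ (toUnitSphere B ⟨v, h⟩) := fun v h ↦ dif_pos h
  refine taut_of_exists_eq_smul (I := I) (s := s)
    (continuousOn_dite_ne_zero (V := E) (hσ.comp (continuous_toUnitSphere B)) 1)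
    (fun c hc x ↦ ?_) h0 hφ (fun x hx ↦ hr ⟨_, (hsv x hx).symm⟩)
    (fun F hF ↦ exists_eq_smul_of_odd_finrank hn hF) ?_
  · by_cases hx : x = 0
    · simp [hx]
    · rw [hsv _ (smul_ne_zero hc.ne' hx), hsv x hx, toUnitSphere_smul B hc hx]
  · ext g
    simp only [orientedSpace, mem_iUnion, mem_ofPred_eq]
    constructor
    · rintro ⟨⟨x, hx⟩, t, rfl⟩
      exact ⟨x, ne_zero_of_mem_unitSphere B hx, t, by
        rw [hsv x (ne_zero_of_mem_unitSphere B hx), toUnitSphere_of_mem B hx]; rfl⟩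
    · rintro ⟨x, hx, t, rfl⟩
      refine ⟨toUnitSphere B ⟨x, hx⟩, t * √(B.inner x x), ?_⟩
      have h : (t * √(B.inner x x)) • ((toUnitSphere B ⟨x, hx⟩ : unitSphere B) : E) = t • x := by
        simp only [toUnitSphere, smul_smul]
        rw [mul_assoc, mul_inv_cancel₀ (Real.sqrt_pos.2 (inner_self_pos_of_core B hx)).ne', mul_one]
      rw [hsv x hx, ← h]
      rfl

end Configurations

end Kakeya

end

theorem mainTheorem4
    {E : Type*} [NormedAddCommGroup E] [NormedSpace ℝ E] [FiniteDimensional ℝ E]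
    {H : Type*} [TopologicalSpace H] (I : ModelWithCorners ℝ E H) [I.Boundaryless]
    (G : Type*) [TopologicalSpace G] [ChartedSpace H G] [Group G] [LieGroup I ∞ G]
    [T2Space G] [ConnectedSpace G] [MeasurableSpace G] [BorelSpace G] :
    (0 < Module.finrank ℝ (GroupLieAlgebra I G) →
      ∀ σ : ℙ ℝ (GroupLieAlgebra I G) → G, Continuous σ → Kakeya.IsTaut I σ →
        (∃ W : Set G, IsOpen W ∧ 1 ∈ W ∧ W ⊆ Kakeya.unorientedSpace I σ) ∧
        MeasurableSet (Kakeya.unorientedSpace I σ) ∧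
        ∀ μ : MeasureTheory.Measure G, μ.IsHaarMeasure → 0 < μ (Kakeya.unorientedSpace I σ)) ∧
    (Odd (Module.finrank ℝ (GroupLieAlgebra I G)) →
      ∀ (B : InnerProductSpace.Core ℝ (GroupLieAlgebra I G))
        (σ : Kakeya.unitSphere B → G), Continuous σ → Kakeya.IsTaut I σ →
        (∃ W : Set G, IsOpen W ∧ 1 ∈ W ∧ W ⊆ Kakeya.orientedSpace I B σ) ∧
        MeasurableSet (Kakeya.orientedSpace I B σ) ∧
        ∀ μ : MeasureTheory.Measure G, μ.IsHaarMeasure → 0 < μ (Kakeya.orientedSpace I B σ)) := by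
  exact ⟨fun hn σ hσ htaut ↦ Kakeya.taut_unoriented I hn σ hσ htaut,
    fun hn B σ hσ htaut ↦ Kakeya.taut_oriented I hn B σ hσ htaut⟩
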